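/- Let $\mathbb D^2=\{z\in\mathbb C^2:|z_1|<1,|z_2|<1\}$. A rational inner function on $\mathbb D^2$ is a bounded function $\phi=q/r$ with $q,r\in\mathbb C[z_1,z_2]$, $r$ zero-free in $\mathbb D^2$, having unimodular non-tangential boundary values at almost every point of the torus $\mathbb T^2$; a rational inner mapping (RIM) is a map $\Phi=(\phi_1,\phi_2)\colon\mathbb D^2\to\mathbb D^2$ whose components are rational inner functions. Let $\Phi=(\phi_1,\phi_2)$ be a RIM and write, for $j=1,2$, $$\phi_j(z)=e^{i\alpha_j}z_1^{\beta_{j,1}}z_2^{\beta_{j,2}}\,\frac{\tilde p_j(z)}{p_j(z)},\qquad \alpha_j\in\mathbb R,\quad \beta_{j,1},\beta_{j,2}\in\mathbb N=\{0,1,2,\dots\},$$ where $p_j\in\mathbb C[z_1,z_2]$ has no zeros in $\mathbb D^2$, $\tilde p_j(z)=z_1^{m_j}z_2^{l_j}\,\overline{p_j(1/\bar z_1,1/\bar z_2)}$ is the reflection of $p_j$ (with $(m_j,l_j)$ the bidegree of $p_j$), and $p_j$, $\tilde p_j$ have no common factor (the normalized case is $\beta_{j,1}=\beta_{j,2}=0$).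 Let $n_1,n_2\ge 0$ be integers such that $\Phi$ has bidegree at most $(n_1,n_2)$, i.e. $\beta_{j,1}+m_j\le n_1$ and $\beta_{j,2}+l_j\le n_2$ for $j=1,2$ (for instance, both components have bidegree exactly $(n_1,n_2)$). Define the fixed-point polynomials $$P_j(z)=e^{i\alpha_j}z_1^{\beta_{j,1}}z_2^{\beta_{j,2}}\,\tilde p_j(z)-z_j\,p_j(z),\qquad j=1,2,$$ and $$\Gamma(\Phi)=\{z\in\mathbb C^2:\ |z_1|\le 1,\ |z_2|\le 1,\ P_1(z)=P_2(z)=0\}.$$ If $P_1$ and $P_2$ have no common factor, then $\Gamma(\Phi)$ is a finite set, and its cardinality is at most $(n_1+1)(n_2+1)+n_1n_2=2n_1n_2+n_1+n_2+1$. -/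

import Mathlib

open MvPolynomial Filter Topology

noncomputable section

namespace RationalInner

/-- The open unit bidisk. -/
def bidisk : Set (Fin 2 → ℂ) := {z | ∀ i, ‖z i‖ < 1}

/-- The closed unit bidisk. -/
def closedBidisk : Set (Fin 2 → ℂ) := {z | ∀ i, ‖z i‖ ≤ 1}

/-- The point `(exp (i θ₁), exp (i θ₂))` of the two-torus. -/
def torusPoint (θ : Fin 2 → ℝ) : Fin 2 → ℂ := fun i => Complex.exp (θ i * Complex.I)

/-- The non-tangential approach region in the bidisk with vertex `ζ` and aperture `c`. -/
def approachRegion (ζ : Fin 2 → ℂ) (c : ℝ) : Set (Fin 2 → ℂ) :=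
  {z | z ∈ bidisk ∧ ∀ i, ‖z i - ζ i‖ < c * (1 - ‖z i‖)}

/-- `w` is the non-tangential limit of `φ` at the torus point `ζ`. -/
def HasNontangentialLimit (φ : (Fin 2 → ℂ) → ℂ) (ζ : Fin 2 → ℂ) (w : ℂ) : Prop :=
  ∀ c : ℝ, 1 < c → Tendsto φ (𝓝[approachRegion ζ c] ζ) (𝓝 w)

/-- Rational inner functions on the bidisk: bounded quotients `q / p` of polynomials, `p` without
zeros in the bidisk, with unimodular non-tangential boundary values almost everywhere on the
torus (null sets of the torus are the null sets in the angles). -/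
structure IsRationalInner (φ : (Fin 2 → ℂ) → ℂ) : Prop where
  rational : ∃ q p : MvPolynomial (Fin 2) ℂ,
    (∀ z ∈ bidisk, eval z p ≠ 0) ∧ ∀ z ∈ bidisk, φ z = eval z q / eval z p
  bounded : ∃ C : ℝ, ∀ z ∈ bidisk, ‖φ z‖ ≤ C
  unimodular : ∀ᵐ θ : Fin 2 → ℝ,
    ∃ w : ℂ, ‖w‖ = 1 ∧ HasNontangentialLimit φ (torusPoint θ) w

/-- Rational inner mappings: self-maps of the bidisk with rational inner components. -/
structure IsRIM (Φ : (Fin 2 → ℂ) → (Fin 2 → ℂ)) : Prop where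
  mapsTo : Set.MapsTo Φ bidisk bidisk
  component : ∀ j, IsRationalInner (fun z => Φ z j)

/-- The bidegree of a polynomial in two variables. -/
def bidegree (p : MvPolynomial (Fin 2) ℂ) : Fin 2 →₀ ℕ :=
  Finsupp.equivFunOnFinite.symm fun i => p.degreeOf i

/-- The reflection `z₁ ^ m * z₂ ^ n * conj (p (1 / conj z₁, 1 / conj z₂))` of a polynomial `p` of
bidegree `(m, n)`, written out: each term `a * z ^ s` of `p` becomes `conj a * z ^ ((m, n) - s)`. -/
def reflection (p : MvPolynomial (Fin 2) ℂ) : MvPolynomial (Fin 2) ℂ :=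
  ∑ s ∈ p.support, monomial (bidegree p - s) (starRingEnd ℂ (coeff s p))

/-- The numerator `exp (i α) * z ^ β * p̃` of a rational inner function with denominator `p`. -/
def numerator (α : ℝ) (β : Fin 2 →₀ ℕ) (p : MvPolynomial (Fin 2) ℂ) : MvPolynomial (Fin 2) ℂ :=
  monomial β (Complex.exp (α * Complex.I)) * reflection p

/-- `φ = exp (i α) * z ^ β * p̃ / p` on the bidisk, where `p` has no zeros in the bidisk and is
atoral, i.e. `p` and `p̃` have no common factor. The bidegree of `φ` is then
`β + bidegree p`, and `φ` is normalized when `β = 0`. -/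
structure IsRepresentedBy (φ : (Fin 2 → ℂ) → ℂ) (α : ℝ) (β : Fin 2 →₀ ℕ)
    (p : MvPolynomial (Fin 2) ℂ) : Prop where
  ne_zero : ∀ z ∈ bidisk, eval z p ≠ 0
  atoral : IsRelPrime p (reflection p)
  eq_div : ∀ z ∈ bidisk, φ z = eval z (numerator α β p) / eval z p

/-- The `j`-th fixed-point polynomial `P_j = exp (i α) * z ^ β * p̃ - z_j * p`. -/
def fixedPointPoly (j : Fin 2) (α : ℝ) (β : Fin 2 →₀ ℕ) (p : MvPolynomial (Fin 2) ℂ) :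
    MvPolynomial (Fin 2) ℂ :=
  numerator α β p - X j * p

/-- The common zeros of two polynomials in the closed bidisk. -/
def commonZeros (P : Fin 2 → MvPolynomial (Fin 2) ℂ) : Set (Fin 2 → ℂ) :=
  {z | z ∈ closedBidisk ∧ ∀ j, eval z (P j) = 0}

/-- The set `Γ(Φ)`, for the mapping `Φ` whose components are represented by the given data. -/
def Gam (α : Fin 2 → ℝ) (β : Fin 2 → Fin 2 →₀ ℕ) (p : Fin 2 → MvPolynomial (Fin 2) ℂ) :
    Set (Fin 2 → ℂ) :=
  commonZeros fun j => fixedPointPoly j (α j) (β j) (p j)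

end RationalInner

end

/-! This is Bézout's bound on P¹ × P¹: coprime `f`, `g` of bidegrees (a, b), (c, d) have at most ad
+ cb common zeros in the whole plane, so neither innerness nor the closed bidisk matters. The bound
is linear algebra in boxes of polynomials with bounded degrees. Every `f * h + g * k` vanishes on a
finite set `Z` of common zeros, which costs `Z.card` dimensions in a large box, as interpolation on
`Z` is possible there (`exists_box_interpolation`). By coprimality the only relations are the Koszul
ones (`exists_koszul`), so rank-nullity bounds `Z.card`. The factor z_j raises only the degree of
P_j in its own variable, giving bidegrees (n₁ + 1, n₂) and (n₁, n₂ + 1). -/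

namespace MvPolynomial

/-! ### Boxes of polynomials and interpolation -/

section Box

variable {σ K : Type*} [Field K]

/-- The polynomials whose degree in each variable `i` is less than `N i`. -/
noncomputable def box (K : Type*) [Field K] (N : σ → ℕ) : Submodule K (MvPolynomial σ K) :=
  restrictSupport K {s | ∀ i, s i < N i}

theorem mem_box_of_degreeOf_lt {N : σ → ℕ} {f : MvPolynomial σ K}
    (h : ∀ i, f.degreeOf i < N i) : f ∈ box K N := by
  intro s hs i
  exact (degreeOf_le_iff.1 le_rfl s hs).trans_lt (h i)

theorem degreeOf_lt_of_mem_box {N : σ → ℕ} {f : MvPolynomial σ K} (hf : f ∈ box K N)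
    -- Zero must be excluded: it has degree 0, while `N i` may be 0.
    (h0 : f ≠ 0) (i : σ) : f.degreeOf i < N i := by
  have hf' : ∀ s ∈ f.support, ∀ i, s i < N i := fun s hs => hf hs
  obtain ⟨s, hs⟩ := support_nonempty.2 h0
  exact (degreeOf_lt_iff ((Nat.zero_le _).trans_lt (hf' s hs i))).2 fun s hs => hf' s hs i

theorem mul_mem_box {N : σ → ℕ} (f : MvPolynomial σ K) {h : MvPolynomial σ K}
    (hh : h ∈ box K fun i => N i - f.degreeOf i) : f * h ∈ box K N := by
  rcases eq_or_ne h 0 with rfl | h0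
  · simp
  refine mem_box_of_degreeOf_lt fun i => ?_
  have h1 := degreeOf_lt_of_mem_box hh h0 i
  have h2 := degreeOf_mul_le i f h
  omega

/-- Over a field, degrees in each variable add exactly under multiplication. -/
theorem mem_box_of_mul_mem_box {N : σ → ℕ} {f h : MvPolynomial σ K} (hf : f ≠ 0)
    (hh : f * h ∈ box K N) : h ∈ box K fun i => N i - f.degreeOf i := by
  rcases eq_or_ne h 0 with rfl | h0
  · simp
  refine mem_box_of_degreeOf_lt fun i => ?_
  have h1 := degreeOf_lt_of_mem_box hh (mul_ne_zero hf h0) i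
  rw [degreeOf_mul_eq hf h0] at h1
  omega

/-- The exponents of the monomials in a box, as a product of finite types. -/
noncomputable def boxExponents [Finite σ] (N : σ → ℕ) : {s : σ →₀ ℕ | ∀ i, s i < N i} ≃ ∀ i, Fin (N i) where
  toFun s i := ⟨s.1 i, s.2 i⟩
  invFun t := ⟨Finsupp.equivFunOnFinite.symm fun i => t i, fun i => (t i).2⟩
  left_inv s := by ext; rfl
  right_inv t := rfl

instance [Finite σ] (N : σ → ℕ) : Module.Finite K (box K N) :=
  have : Finite {s : σ →₀ ℕ | ∀ i, s i < N i} := Finite.of_equiv _ (boxExponents N).symm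
  Module.Finite.of_basis (basisRestrictSupport K {s : σ →₀ ℕ | ∀ i, s i < N i})

theorem finrank_box [Fintype σ] (N : σ → ℕ) : Module.finrank K (box K N) = ∏ i, N i := by
  have h := Module.finrank_eq_nat_card_basis
    (basisRestrictSupport K {s : σ →₀ ℕ | ∀ i, s i < N i})
  rw [Nat.card_congr (boxExponents N), Nat.card_pi] at h
  exact h.trans (by simp)

/-- Evaluation at the points of a finite set. -/
noncomputable def evalOn (Z : Finset (σ → K)) : MvPolynomial σ K →ₗ[K] (Z → K) :=
  LinearMap.pi fun z => (aeval (R := K) z.1).toLinearMap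

theorem evalOn_apply (Z : Finset (σ → K)) (f : MvPolynomial σ K) (z : Z) :
    evalOn Z f z = eval z.1 f := by
  simp [evalOn, aeval_eq_eval]

/-- Lagrange interpolation: for each other point, take an affine factor in a coordinate where it
differs from `z`. -/
theorem exists_eval_eq_ite [DecidableEq (σ → K)] (Z : Finset (σ → K)) (z : σ → K) :
    ∃ f : MvPolynomial σ K, ∀ w ∈ Z, eval w f = if w = z then 1 else 0 := by
  have key : ∀ w : σ → K, ∃ f : MvPolynomial σ K, w ≠ z → eval z f = 1 ∧ eval w f = 0 := by
    intro w
    by_cases hw : w = z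
    · exact ⟨0, fun h => (h hw).elim⟩
    obtain ⟨i, hi⟩ := Function.ne_iff.1 hw
    refine ⟨C (z i - w i)⁻¹ * (X i - C (w i)), fun _ => ⟨?_, by simp⟩⟩
    simpa using inv_mul_cancel₀ (sub_ne_zero.2 hi.symm)
  choose F hF using key
  refine ⟨∏ v ∈ Z.erase z, F v, fun w hw => ?_⟩
  rw [eval_prod]
  split_ifs with h
  · subst h
    exact Finset.prod_eq_one fun v hv => (hF v (Finset.ne_of_mem_erase hv)).1
  · exact Finset.prod_eq_zero (Finset.mem_erase.2 ⟨h, hw⟩) (hF w h).2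

/-- Polynomials of large enough degrees interpolate arbitrary values on a finite set. -/
theorem exists_box_interpolation (Z : Finset (σ → K)) :
    ∃ M : ℕ, ∀ N : σ → ℕ, (∀ i, M ≤ N i) →
      Function.Surjective ((evalOn Z).domRestrict (box K N)) := by
  classical
  choose F hF using exists_eval_eq_ite Z
  refine ⟨(Z.sup fun z => (F z).totalDegree) + 1, fun N hN v => ?_⟩
  have hmem : ∑ z : Z, v z • F z ∈ box K N := by
    refine Submodule.sum_mem _ fun z _ => Submodule.smul_mem _ _ <|
      mem_box_of_degreeOf_lt fun i => ?_
    have h1 := degreeOf_le_totalDegree (F z) i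
    have h2 := Finset.le_sup (f := fun z => (F z).totalDegree) z.2
    have h3 := hN i
    omega
  refine ⟨⟨_, hmem⟩, ?_⟩
  ext w
  rw [LinearMap.domRestrict_apply, evalOn_apply, eval_sum]
  simp [smul_eval, hF _ _ w.2, Subtype.ext_iff.symm]

end Box

/-! ### Bézout's bound by dimension count -/

section Bezout

variable {K : Type*} [Field K]

/-- The syzygies of a coprime pair inside boxes come from the Koszul relation. -/
theorem exists_koszul {σ : Type*} {f g h k : MvPolynomial σ K} (hg : g ≠ 0)
    (hfg : IsRelPrime f g) (N : σ → ℕ) (hh : h ∈ box K fun i => N i - f.degreeOf i)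
    (e : f * h + g * k = 0) :
    ∃ m ∈ box K fun i => N i - f.degreeOf i - g.degreeOf i, h = g * m ∧ k = -(f * m) := by
  have hdvd : g ∣ f * h := ⟨-k, by linear_combination e⟩
  obtain ⟨m, rfl⟩ := hfg.symm.dvd_of_dvd_mul_left hdvd
  refine ⟨m, mem_box_of_mul_mem_box hg hh, rfl, ?_⟩
  apply mul_left_cancel₀ hg
  linear_combination e

/-- The dimension count behind the bihomogeneous Bézout bound. -/
theorem card_add_le_of_common_zeros {σ : Type*} [Fintype σ] {f g : MvPolynomial σ K}
    (hg : g ≠ 0) (hfg : IsRelPrime f g) (Z : Finset (σ → K))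
    (hZ : ∀ z ∈ Z, eval z f = 0 ∧ eval z g = 0) :
    ∃ M : ℕ, ∀ N : σ → ℕ, (∀ i, M ≤ N i) →
      Z.card + ∏ i, (N i - f.degreeOf i) + ∏ i, (N i - g.degreeOf i) ≤
        ∏ i, N i + ∏ i, (N i - f.degreeOf i - g.degreeOf i) := by
  obtain ⟨M, hM⟩ := exists_box_interpolation Z
  refine ⟨M, fun N hN => ?_⟩
  let E := (evalOn Z).domRestrict (box K N)
  let A := box K fun i => N i - f.degreeOf i
  let B := box K fun i => N i - g.degreeOf i
  let D := box K fun i => N i - f.degreeOf i - g.degreeOf i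
  let T₀ : A × B →ₗ[K] MvPolynomial σ K :=
    ((LinearMap.mulLeft K f) ∘ₗ A.subtype).coprod ((LinearMap.mulLeft K g) ∘ₗ B.subtype)
  have hT₀ : ∀ x, T₀ x = f * x.1.1 + g * x.2.1 := fun x => by simp [T₀]
  let T₁ : A × B →ₗ[K] box K N := T₀.codRestrict _ fun x => by
    rw [hT₀]
    exact add_mem (mul_mem_box f x.1.2) (mul_mem_box g x.2.2)
  let T : A × B →ₗ[K] LinearMap.ker E := T₁.codRestrict _ fun x => by
    rw [LinearMap.mem_ker]
    ext z
    change evalOn Z (T₀ x) z = 0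
    rw [evalOn_apply, hT₀]
    simp [(hZ z.1 z.2).1, (hZ z.1 z.2).2]
  let W : D →ₗ[K] A × B :=
    (((LinearMap.mulLeft K g) ∘ₗ D.subtype).codRestrict A fun m => mul_mem_box g m.2).prod
      ((-((LinearMap.mulLeft K f) ∘ₗ D.subtype)).codRestrict B fun m => by
        refine neg_mem (mul_mem_box f ?_)
        simp only [Nat.sub_right_comm]
        exact m.2)
  -- Only this inclusion is needed: it bounds the nullity of `T` by the dimension of `D`.
  have hker : LinearMap.ker T ≤ LinearMap.range W := by
    rintro ⟨h, k⟩ hx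
    have hx' : T₀ (h, k) = 0 := congrArg (fun y => (y.1.1 : MvPolynomial σ K)) hx
    rw [hT₀] at hx'
    obtain ⟨m, hm, h1, h2⟩ := exists_koszul hg hfg N h.2 hx'
    exact ⟨⟨m, hm⟩, Prod.ext (Subtype.ext h1.symm) (Subtype.ext h2.symm)⟩
  have e1 := LinearMap.finrank_range_add_finrank_ker E
  have e2 := LinearMap.finrank_range_add_finrank_ker (V := A × B) (V₂ := LinearMap.ker E) T
  have e3 := (LinearMap.range T).finrank_le
  have e4 := (Submodule.finrank_mono hker).trans W.finrank_range_le
  rw [LinearMap.range_eq_top.2 (hM N hN), finrank_top, Module.finrank_fintype_fun_eq_card,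
    Fintype.card_coe, finrank_box] at e1
  rw [Module.finrank_prod, finrank_box, finrank_box] at e2
  rw [finrank_box] at e4
  omega

/-- Bézout's bound for curves of given bidegrees. -/
theorem card_le_of_common_zeros {f g : MvPolynomial (Fin 2) K} (hfg : IsRelPrime f g)
    {a b c d : ℕ} (ha : f.degreeOf 0 ≤ a) (hb : f.degreeOf 1 ≤ b) (hc : g.degreeOf 0 ≤ c)
    (hd : g.degreeOf 1 ≤ d) (Z : Finset (Fin 2 → K))
    (hZ : ∀ z ∈ Z, eval z f = 0 ∧ eval z g = 0) : Z.card ≤ a * d + c * b := by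
  rcases Z.eq_empty_or_nonempty with rfl | ⟨z, hz⟩
  · simp
  -- If `g = 0`, coprimality makes `f` a unit, which cannot vanish at `z`.
  have hg : g ≠ 0 := by
    rintro rfl
    have hu := (isRelPrime_zero_right.1 hfg).map (eval z)
    rw [(hZ z hz).1] at hu
    exact not_isUnit_zero hu
  obtain ⟨M, hM⟩ := card_add_le_of_common_zeros hg hfg Z hZ
  -- With these sizes every truncated subtraction is exact, and all terms in `M` cancel.
  have h := hM (fun i => f.degreeOf i + g.degreeOf i + M) fun i => by omega
  have s1 : ∀ x y : ℕ, x + y + M - x = y + M := by intros; omega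
  have s2 : ∀ x y : ℕ, x + y + M - y = x + M := by intros; omega
  have s3 : ∀ y : ℕ, y + M - y = M := by intros; omega
  simp only [Fin.prod_univ_two, s1, s2, s3] at h
  have h' : Z.card ≤ f.degreeOf 0 * g.degreeOf 1 + g.degreeOf 0 * f.degreeOf 1 := by
    nlinarith only [h]
  exact h'.trans (by gcongr)

/-- The bound is uniform over finite subsets, so it forces finiteness. -/
theorem finite_and_ncard_le_of_common_zeros {f g : MvPolynomial (Fin 2) K}
    (hfg : IsRelPrime f g) {a b c d : ℕ} (ha : f.degreeOf 0 ≤ a) (hb : f.degreeOf 1 ≤ b)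
    (hc : g.degreeOf 0 ≤ c) (hd : g.degreeOf 1 ≤ d) {S : Set (Fin 2 → K)}
    (hS : ∀ z ∈ S, eval z f = 0 ∧ eval z g = 0) : S.Finite ∧ S.ncard ≤ a * d + c * b := by
  have hfin : S.Finite := by
    by_contra hinf
    obtain ⟨Z, hZS, hZ⟩ := Set.Infinite.exists_subset_card_eq hinf (a * d + c * b + 1)
    have := card_le_of_common_zeros hfg ha hb hc hd Z fun z hz => hS z (hZS hz)
    omega
  refine ⟨hfin, ?_⟩
  rw [Set.ncard_eq_toFinset_card S hfin]
  exact card_le_of_common_zeros hfg ha hb hc hd _ fun z hz => hS z (by simpa using hz)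

end Bezout

end MvPolynomial

/-! ### Degrees of the fixed-point polynomials -/

namespace RationalInner

theorem degreeOf_reflection_le (p : MvPolynomial (Fin 2) ℂ) (i : Fin 2) :
    (reflection p).degreeOf i ≤ bidegree p i := by
  refine (degreeOf_sum_le i _ _).trans (Finset.sup_le fun s hs => ?_)
  rw [degreeOf_monomial_eq _ _ (by simpa using hs)]
  simp

theorem degreeOf_fixedPointPoly_le (j : Fin 2) (α : ℝ) (β : Fin 2 →₀ ℕ)
    (p : MvPolynomial (Fin 2) ℂ) (i : Fin 2) :
    (fixedPointPoly j α β p).degreeOf i ≤ (β + bidegree p) i + if i = j then 1 else 0 := by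
  refine (degreeOf_sub_le i _ _).trans (max_le ?_ ?_)
  · refine (degreeOf_mul_le i _ _).trans ?_
    rw [degreeOf_monomial_eq _ _ (Complex.exp_ne_zero _)]
    have := degreeOf_reflection_le p i
    simp only [Finsupp.add_apply]
    omega
  · refine (degreeOf_mul_le i _ _).trans ?_
    rw [degreeOf_X]
    simp only [Finsupp.add_apply, bidegree, Finsupp.equivFunOnFinite_symm_apply_apply]
    omega

end RationalInner

theorem mainTheorem6
    (Φ : (Fin 2 → ℂ) → (Fin 2 → ℂ)) (hΦ : RationalInner.IsRIM Φ)
    (α : Fin 2 → ℝ) (β : Fin 2 → Fin 2 →₀ ℕ) (p : Fin 2 → MvPolynomial (Fin 2) ℂ)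
    (hrep : ∀ j, RationalInner.IsRepresentedBy (fun z => Φ z j) (α j) (β j) (p j))
    (n₁ n₂ : ℕ)
    (hn₁ : ∀ j, (β j + RationalInner.bidegree (p j)) 0 ≤ n₁)
    (hn₂ : ∀ j, (β j + RationalInner.bidegree (p j)) 1 ≤ n₂)
    (hP : IsRelPrime (RationalInner.fixedPointPoly 0 (α 0) (β 0) (p 0))
      (RationalInner.fixedPointPoly 1 (α 1) (β 1) (p 1))) :
    (RationalInner.Gam α β p).Finite ∧
      (RationalInner.Gam α β p).ncard ≤ 2 * n₁ * n₂ + n₁ + n₂ + 1 := by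
  have hdeg := fun j => RationalInner.degreeOf_fixedPointPoly_le j (α j) (β j) (p j)
  -- Here `a * d + c * b` is (n₁ + 1)(n₂ + 1) + n₁n₂.
  have hbound := MvPolynomial.finite_and_ncard_le_of_common_zeros hP
    (a := n₁ + 1) (b := n₂) (c := n₁) (d := n₂ + 1)
    ((hdeg 0 0).trans (by simpa using hn₁ 0)) ((hdeg 0 1).trans (by simpa using hn₂ 0))
    ((hdeg 1 0).trans (by simpa using hn₁ 1)) ((hdeg 1 1).trans (by simpa using hn₂ 1))
    (S := RationalInner.Gam α β p) fun z hz => ⟨hz.2 0, hz.2 1⟩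
  exact ⟨hbound.1, hbound.2.trans (by ring_nf; rfl)⟩
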